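/- Let $n \ge 2$ be an integer, let $s_i = 5\cdot 2^{n+i} - 3$ for $i \in \mathbb{N} = \{0,1,2,\dots\}$, and let $S = GT(n,2) = \langle \{ s_i : i \in \mathbb{N}\}\rangle$ be the submonoid of $(\mathbb{N},+)$ generated by the $s_i$. Let $F(S)$ be the Frobenius number of $S$, i.e. the greatest natural number not in $S$, and let $Ap(S,s_0) = \{ s \in S : s - s_0 \notin S\}$ be the Apéry set of $S$ with respect to $s_0 = 5\cdot 2^n - 3$. If $n \ge 3$, then $$\max Ap(S,s_0) = 2s_{n-2} + s_{n-1} + s_{n+2} \quad\text{and}\quad F(S) = 25\cdot 2^{2n} - 5\cdot 2^n - 9 .$$ If $n = 2$, then $$\max Ap(S,s_0) = s_1 + s_4 \quad\text{and}\quad F(S) = 337 .$$ -/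

import Mathlib

/-- The generator `s_i = (2^k + 1) * 2^(n+i) - (2^k - 1)` of the generalized Thabit numerical
semigroup; the natural-number subtractions are exact, since `2^k - 1 < 2^k + 1`. -/
def thabitGen (n k i : ℕ) : ℕ := (2 ^ k + 1) * 2 ^ (n + i) - (2 ^ k - 1)

/-- `GT(n, k)`: the submonoid of `(ℕ, +)` generated by all the `s_i`, `i ∈ ℕ`. -/
def GT (n k : ℕ) : AddSubmonoid ℕ :=
  AddSubmonoid.closure (Set.range (thabitGen n k))

/-- The Apéry set `{s ∈ S | s - x ∉ S}`, the difference being taken in `ℤ`: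
no `t ∈ S` satisfies `t = s - x`. -/
def aperySet (S : AddSubmonoid ℕ) (x : ℕ) : Set ℕ :=
  {s | s ∈ S ∧ ∀ t ∈ S, (t : ℤ) ≠ (s : ℤ) - (x : ℤ)}

/-! Write m = s_0 and L = `twoLegendre`. Since s_i + 3 = 2^i (m + 3), trading two copies of s_i for
one s_{i+1} adds 3. Hence S consists of the numbers t m + 3 j with j ≤ L(t) (`mem_GT_two_iff`). As 3
is invertible mod m, every residue class has a unique j < m. If t₀ is the last t with L(t) < m - 1,
the largest gap is t₀ m + 3 (m - 1). For n ≥ 3, t₀ = 5·2^n - 1; for n = 2, t₀ = 17. The Apéry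
maximum is F(S) + m. -/

/-- Legendre's formula for the exponent of `2` in `t!`, as a recursion. -/
def twoLegendre (t : ℕ) : ℕ :=
  if t = 0 then 0 else t / 2 + twoLegendre (t / 2)
termination_by t
decreasing_by omega

theorem twoLegendre_eq (t : ℕ) : twoLegendre t = t / 2 + twoLegendre (t / 2) := by
  rcases Nat.eq_zero_or_pos t with rfl | h
  · simp [twoLegendre]
  · rw [twoLegendre, if_neg h.ne']

theorem twoLegendre_zero : twoLegendre 0 = 0 := by simp [twoLegendre]

theorem twoLegendre_two_mul (t : ℕ) : twoLegendre (2 * t) = t + twoLegendre t := by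
  rw [twoLegendre_eq, Nat.mul_div_cancel_left t two_pos]

theorem twoLegendre_two_mul_add_one (t : ℕ) : twoLegendre (2 * t + 1) = t + twoLegendre t := by
  rw [twoLegendre_eq, show (2 * t + 1) / 2 = t by omega]

theorem twoLegendre_mono : Monotone twoLegendre := by
  intro a b
  induction b using Nat.strong_induction_on generalizing a with
  | _ b ih =>
    intro hab
    rcases Nat.eq_zero_or_pos b with rfl | hb
    · rw [Nat.le_zero.mp hab]
    · have := ih (b / 2) (by omega) (a := a / 2) (by omega)
      rw [twoLegendre_eq a, twoLegendre_eq b]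
      omega

/-- Makes the set of t m + 3 j with j ≤ L(t) closed under addition. -/
theorem twoLegendre_add_le (a b : ℕ) :
    twoLegendre a + twoLegendre b ≤ twoLegendre (a + b) := by
  induction h : a + b using Nat.strong_induction_on generalizing a b with
  | _ c ih =>
    rcases Nat.eq_zero_or_pos c with rfl | hc
    · obtain ⟨rfl, rfl⟩ : a = 0 ∧ b = 0 := by omega
      simp [twoLegendre_zero]
    · have h1 := ih (a / 2 + b / 2) (by omega) (a / 2) (b / 2) rfl
      have h2 : twoLegendre (a / 2 + b / 2) ≤ twoLegendre (c / 2) := twoLegendre_mono (by omega)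
      rw [twoLegendre_eq a, twoLegendre_eq b, twoLegendre_eq c]
      omega

theorem twoLegendre_le (t : ℕ) : twoLegendre t ≤ t := by
  induction t using Nat.strong_induction_on with
  | _ t ih =>
    rcases Nat.eq_zero_or_pos t with rfl | ht
    · simp [twoLegendre_zero]
    · have := ih (t / 2) (by omega)
      rw [twoLegendre_eq]
      omega

theorem twoLegendre_two_pow (i : ℕ) : twoLegendre (2 ^ i) + 1 = 2 ^ i := by
  induction i with
  | zero => simp [twoLegendre]
  | succ i ih => rw [pow_succ', twoLegendre_two_mul]; omega

theorem twoLegendre_five_mul_two_pow (n : ℕ) :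
    twoLegendre (5 * 2 ^ n) + 2 = 5 * 2 ^ n := by
  induction n with
  | zero => simp [twoLegendre]
  | succ n ih =>
    rw [show 5 * 2 ^ (n + 1) = 2 * (5 * 2 ^ n) by ring, twoLegendre_two_mul]; omega

theorem twoLegendre_five_mul_two_pow_sub_one (n : ℕ) :
    twoLegendre (5 * 2 ^ n - 1) + n + 2 = 5 * 2 ^ n := by
  induction n with
  | zero => simp [twoLegendre]
  | succ n ih =>
    have := Nat.one_le_two_pow (n := n)
    rw [show 5 * 2 ^ (n + 1) - 1 = 2 * (5 * 2 ^ n - 1) + 1 by rw [pow_succ]; omega,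
      twoLegendre_two_mul_add_one, pow_succ]
    omega

theorem thabitGen_two (n i : ℕ) : thabitGen n 2 i = 5 * 2 ^ (n + i) - 3 := rfl

theorem thabitGen_two_add_three (n i : ℕ) : thabitGen n 2 i + 3 = 5 * 2 ^ (n + i) := by
  have := Nat.one_le_two_pow (n := n + i)
  rw [thabitGen_two]; omega

theorem thabitGen_two_succ (n i : ℕ) : thabitGen n 2 (i + 1) = 2 * thabitGen n 2 i + 3 := by
  have h1 := thabitGen_two_add_three n i
  have h2 := thabitGen_two_add_three n (i + 1)
  rw [← add_assoc, pow_succ] at h2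
  omega

theorem thabitGen_mem (n i : ℕ) : thabitGen n 2 i ∈ GT n 2 :=
  AddSubmonoid.subset_closure ⟨i, rfl⟩

/-- Each pair of s_i merged into s_{i+1} gains 3. If j ≥ t / 2, merge every pair and recurse on the
t / 2 copies of s_{i+1}; otherwise j merges suffice. -/
theorem mul_thabitGen_add_mem (n i t j : ℕ) (hj : j ≤ twoLegendre t) :
    t * thabitGen n 2 i + 3 * j ∈ GT n 2 := by
  induction t using Nat.strong_induction_on generalizing i j with
  | _ t ih =>
    have smul_mem (a b : ℕ) : a * thabitGen n 2 b ∈ GT n 2 :=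
      (GT n 2).nsmul_mem (thabitGen_mem n b) a
    rcases Nat.eq_zero_or_pos t with rfl | ht
    · rw [twoLegendre_zero] at hj
      simp [Nat.le_zero.mp hj]
    rw [twoLegendre_eq] at hj
    rcases le_total (t / 2) j with h | h
    · obtain ⟨k, rfl⟩ := Nat.exists_eq_add_of_le h
      have hm := add_mem (smul_mem (t % 2) i)
        (ih (t / 2) (by omega) (i + 1) k (by omega))
      rw [thabitGen_two_succ] at hm
      convert hm using 1
      conv_lhs => rw [← Nat.div_add_mod t 2]
      rw [show (2 * (t / 2) + t % 2) / 2 = t / 2 by omega]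
      ring
    · obtain ⟨k, rfl⟩ := Nat.exists_eq_add_of_le (show 2 * j ≤ t by omega)
      have hm := add_mem (smul_mem k i) (smul_mem j (i + 1))
      rw [thabitGen_two_succ] at hm
      convert hm using 1
      ring

/-- An element of `GT n 2` that is a sum of `k` generators whose powers of two add up to
`t * 2 ^ n` is `t * s_0 + 3 * (t - k)`, and `t - k` ranges over `0, …, twoLegendre t`. -/
theorem mem_GT_two_iff (n x : ℕ) :
    x ∈ GT n 2 ↔ ∃ t j, j ≤ twoLegendre t ∧ x = t * thabitGen n 2 0 + 3 * j := by
  constructor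
  · intro hx
    induction hx using AddSubmonoid.closure_induction with
    | mem x hx =>
      obtain ⟨i, rfl⟩ := hx
      refine ⟨2 ^ i, _, le_rfl, ?_⟩
      have h0 := thabitGen_two_add_three n 0
      have hi := thabitGen_two_add_three n i
      have hl := twoLegendre_two_pow i
      have : 2 ^ i * (thabitGen n 2 0 + 3) = thabitGen n 2 i + 3 := by
        rw [h0, hi, add_zero, pow_add]; ring
      rw [mul_add] at this
      omega
    | zero => exact ⟨0, 0, by simp, by simp⟩
    | add x y _ _ hx hy =>
      obtain ⟨t, j, hj, rfl⟩ := hx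
      obtain ⟨u, k, hk, rfl⟩ := hy
      exact ⟨t + u, j + k, (add_le_add hj hk).trans (twoLegendre_add_le t u), by ring⟩
  · rintro ⟨t, j, hj, rfl⟩
    exact mul_thabitGen_add_mem n 0 t j hj

theorem coprime_three_thabitGen_two (n : ℕ) : Nat.Coprime 3 (thabitGen n 2 0) := by
  have h : Nat.Coprime 3 (thabitGen n 2 0 + 3) := by
    rw [thabitGen_two_add_three]
    exact Nat.Coprime.mul_right (by norm_num) (Nat.Coprime.pow_right _ (by norm_num))
  simpa using h

/-- Choose j < m with 3 j ≡ x mod m. The bound on x forces t > t₀ in x = t m + 3 j, so j ≤ m - 1 ≤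
L(t). -/
theorem mem_GT_two_of_lt (n t₀ x : ℕ)
    (ht₀ : thabitGen n 2 0 ≤ twoLegendre (t₀ + 1) + 1)
    (hx : t₀ * thabitGen n 2 0 + 3 * (thabitGen n 2 0 - 1) < x) : x ∈ GT n 2 := by
  set m := thabitGen n 2 0 with hm
  have hm2 : 2 ≤ m := by
    have := Nat.one_le_two_pow (n := n)
    rw [hm, thabitGen_two, add_zero]; omega
  obtain ⟨c, -, hc⟩ := Nat.exists_mul_mod_eq_one_of_coprime
    (coprime_three_thabitGen_two n) (by omega)
  rw [← hm] at hc
  have hjm : c * x % m < m := Nat.mod_lt _ (by omega)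
  have hmod : 3 * (c * x % m) ≡ x [MOD m] := by
    have h1 : 3 * c ≡ 1 [MOD m] := by rw [Nat.ModEq, hc, Nat.mod_eq_of_lt (by omega)]
    calc 3 * (c * x % m) ≡ 3 * (c * x) [MOD m] := (Nat.mod_modEq _ _).mul_left 3
      _ = 3 * c * x := by ring
      _ ≡ 1 * x [MOD m] := h1.mul_right x
      _ = x := one_mul x
  have hle : 3 * (c * x % m) ≤ x := by
    have := Nat.zero_le (t₀ * m)
    omega
  obtain ⟨t, ht⟩ := (Nat.modEq_iff_dvd' hle).mp hmod
  have hlt : t₀ < t := by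
    by_contra! h
    have := Nat.mul_le_mul_left m h
    rw [mul_comm m t₀] at this
    omega
  have := twoLegendre_mono (show t₀ + 1 ≤ t from hlt)
  refine (mem_GT_two_iff n x).mpr ⟨t, c * x % m, by omega, ?_⟩
  rw [← hm, mul_comm t m]
  omega

theorem isGreatest_aperySet {S : AddSubmonoid ℕ} {x f : ℕ} (hx : 0 < x)
    (hf : IsGreatest {k | k ∉ S} f) : IsGreatest (aperySet S x) (f + x) := by
  refine ⟨⟨?_, ?_⟩, ?_⟩
  · by_contra h
    have := hf.2 h
    omega
  · intro t ht h
    exact hf.1 ((show t = f by push_cast at h; omega) ▸ ht)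
  · rintro s ⟨-, hs⟩
    by_contra! h
    refine hs (s - x) ?_ (by omega)
    by_contra h'
    have := hf.2 h'
    omega

theorem frobeniusNumber_GT_two {n : ℕ} (hn : 3 ≤ n) :
    IsGreatest {k | k ∉ GT n 2} (25 * 2 ^ (2 * n) - 5 * 2 ^ n - 9) := by
  have hN : 8 ≤ 2 ^ n := by simpa using Nat.pow_le_pow_right two_pos hn
  have hm := thabitGen_two_add_three n 0
  rw [add_zero] at hm
  have hcop := coprime_three_thabitGen_two n
  have h5 := twoLegendre_five_mul_two_pow n
  have h5' := twoLegendre_five_mul_two_pow_sub_one n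
  have hmem := mem_GT_two_of_lt n (5 * 2 ^ n - 1)
  have hiff := mem_GT_two_iff n
  set m := thabitGen n 2 0
  rw [mul_comm 2 n, pow_mul]
  have hsq : 25 * (2 ^ n) ^ 2 - 5 * 2 ^ n - 9 + 3 = (m + 5) * m := by
    have h : 25 * (2 ^ n) ^ 2 = (m + 3) * (m + 3) := by rw [hm]; ring
    rw [h, ← hm]
    have : (m + 3) * (m + 3) = (m + 5) * m + m + 9 := by ring
    omega
  refine ⟨?_, ?_⟩
  · intro hF
    obtain ⟨t, j, hj, h⟩ := (hiff _).mp hF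
    have htj : t * m + 3 * (j + 1) = (m + 5) * m := by rw [← hsq, h]; ring
    have hlt : t < m + 5 := by
      by_contra! h
      have := Nat.mul_le_mul_right m h
      omega
    obtain ⟨e, he⟩ := Nat.exists_eq_add_of_lt hlt
    have hem : (e + 1) * m = 3 * (j + 1) := by
      rw [he] at htj
      have : (t + e + 1) * m = t * m + (e + 1) * m := by ring
      omega
    obtain ⟨d, hd⟩ := hcop.dvd_of_dvd_mul_right ⟨_, hem⟩
    have hdj : d * m = j + 1 := by
      rw [hd, mul_assoc] at hem
      omega
    have := twoLegendre_le t
    rcases lt_trichotomy d 1 with h0 | rfl | h2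
    · omega
    -- Here j = m - 1 = 5·2^n - 4, but L(t) = 5·2^n - n - 2 is smaller because n ≥ 3.
    · have ht : t = 5 * 2 ^ n - 1 := by omega
      rw [ht] at hj
      omega
    · have := Nat.mul_le_mul_right m (show 2 ≤ d from h2)
      omega
  · intro x hx
    by_contra! h
    refine hx (hmem x (by rw [Nat.sub_add_cancel (by omega)]; omega) ?_)
    have : (m + 5) * m = (5 * 2 ^ n - 1) * m + 3 * m := by
      rw [← hm, show m + 3 - 1 = m + 2 by omega]; ring
    omega

theorem frobeniusNumber_GT_two_two : IsGreatest {k | k ∉ GT 2 2} 337 := by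
  have hm : thabitGen 2 2 0 = 17 := rfl
  refine ⟨?_, ?_⟩
  · intro hF
    obtain ⟨t, j, hj, h⟩ := (mem_GT_two_iff 2 _).mp hF
    rw [hm] at h
    have := twoLegendre_le t
    -- j ≤ t and 337 = 17 t + 3 j give 17 ≤ t ≤ 19, and mod 3 only 17 survives; then j = 16 > L(17)
    -- = 15.
    have ht : t = 17 := by omega
    subst ht
    simp [twoLegendre] at hj
    omega
  · intro x hx
    by_contra! h
    exact hx (mem_GT_two_of_lt 2 17 x (by simp [hm, twoLegendre]) (by omega))

theorem mainTheorem5 (n : ℕ) (hn : 2 ≤ n) :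
    (3 ≤ n →
      FrobeniusNumber (25 * 2 ^ (2 * n) - 5 * 2 ^ n - 9)
          (Set.range fun i : ℕ => 5 * 2 ^ (n + i) - 3) ∧
        IsGreatest (aperySet (GT n 2) (thabitGen n 2 0))
          (2 * thabitGen n 2 (n - 2) + thabitGen n 2 (n - 1) + thabitGen n 2 (n + 2))) ∧
    (n = 2 →
      FrobeniusNumber 337 (Set.range fun i : ℕ => 5 * 2 ^ (n + i) - 3) ∧
        IsGreatest (aperySet (GT n 2) (thabitGen n 2 0))
          (thabitGen n 2 1 + thabitGen n 2 4)) := by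
  have hpos : 0 < thabitGen n 2 0 := by
    have := Nat.one_le_two_pow (n := n)
    rw [thabitGen_two, add_zero]; omega
  refine ⟨fun h3 => ⟨frobeniusNumber_GT_two h3, ?_⟩, ?_⟩
  · convert isGreatest_aperySet hpos (frobeniusNumber_GT_two h3) using 1
    obtain ⟨k, rfl⟩ := Nat.exists_eq_add_of_le' hn
    have h0 := thabitGen_two_add_three (k + 2) 0
    have h1 := thabitGen_two_add_three (k + 2) k
    have h2 := thabitGen_two_add_three (k + 2) (k + 1)
    have h3 := thabitGen_two_add_three (k + 2) (k + 4)
    have hN := Nat.one_le_two_pow (n := k)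
    -- Ensures that the subtractions in the formula for F(S) do not truncate.
    have hle : 2 ^ k ≤ 2 ^ k * 2 ^ k := Nat.le_mul_of_pos_left _ hN
    rw [show k + 2 - 2 = k by omega, show k + 2 - 1 = k + 1 by omega,
      show k + 2 + 2 = k + 4 by omega]
    rw [show 2 ^ (k + 2 + 0) = 4 * 2 ^ k by ring] at h0
    rw [show 2 ^ (k + 2 + k) = 4 * (2 ^ k * 2 ^ k) by ring] at h1
    rw [show 2 ^ (k + 2 + (k + 1)) = 8 * (2 ^ k * 2 ^ k) by ring] at h2
    rw [show 2 ^ (k + 2 + (k + 4)) = 64 * (2 ^ k * 2 ^ k) by ring] at h3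
    rw [show 2 ^ (2 * (k + 2)) = 16 * (2 ^ k * 2 ^ k) by ring,
      show 2 ^ (k + 2) = 4 * 2 ^ k by ring]
    omega
  · rintro rfl
    exact ⟨frobeniusNumber_GT_two_two, isGreatest_aperySet hpos frobeniusNumber_GT_two_two⟩
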